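/- Let $\mathbb K$ be a discrete field. A topological flow $(V,\phi)$ is a linearly compact $\mathbb K$-vector space $V$ (a Hausdorff topological $\mathbb K$-space having a neighbourhood basis at $0$ of linear subspaces, in which every family of closed linear varieties with the finite intersection property has a common point) with a continuous linear endomorphism $\phi$; an algebraic flow $(W,\psi)$ is a discrete $\mathbb K$-vector space with a linear endomorphism. For a flow $(V,\phi)$ of either kind let $\mathcal B(V)$ be the set of linearly compact open linear subspaces of $V$ and put $$\mathrm{ent}^*(V,\phi)=\sup_{U\in\mathcal B(V)}\lim_{n\to\infty}\tfrac1n\dim\frac{U}{U\cap\phi^{-1}U\cap\dots\cap\phi^{-n+1}U},\qquad \mathrm{ent}(V,\phi)=\sup_{U\in\mathcal B(V)}\lim_{n\to\infty}\tfrac1n\dim\frac{U+\phi U+\dots+\phi^{n-1}U}{U}.$$ A topological flow $(V,\phi)$ has completely positive topological entropy, $\mathrm{ent}^*(V,\phi)\gg0$, if $\mathrm{ent}^*(V/Z,\overline\phi)\ne0$ for every proper closed $\phi$-invariant subspace $Z$; an algebraic flow $(W,\psi)$ has completely positive algebraic entropy, $\mathrm{ent}(W,\psi)\gg0$, if $\mathrm{ent}(Z,\psi|_Z)\neq0$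 for every nonzero $\psi$-invariant subspace $Z$. The Lefschetz dual $\widehat V$ is the space of continuous linear forms $V\to\mathbb K$ with the topology in which the annihilators of the linearly compact subspaces of $V$ are a neighbourhood basis at $0$ (it is discrete for linearly compact $V$), with $\widehat\phi(\chi)=\chi\circ\phi$; for $P\le\widehat V$ let $P^\perp=\{v\in V:\chi(v)=0\ \forall\chi\in P\}$. Theorem B. Let $(V,\phi)$ be a topological flow. Then $V$ has a largest closed $\phi$-invariant subspace $D_+(V,\phi)$ of completely positive topological entropy, and $P_{top}(V,\phi):=V/D_+(V,\phi)$ with the induced map $\overline\phi^t$ is the largest factor of $(V,\phi)$ of zero topological entropy (the Pinsker factor), that is, $D_+(V,\phi)$ is the smallest closed $\phi$-invariant subspace $Z$ with $\mathrm{ent}^*(V/Z,\overline\phi)=0$. Dually, $\widehat V$ has a largest $\widehat\phi$-invariant subspace $P_{alg}(\widehat V,\widehat\phi)$ of zero algebraic entropy (the Pinsker subspace), and it is the smallest $\widehat\phi$-invariant subspace such that the corresponding factor of $(\widehat V,\widehat\phi)$ has completely positive algebraic entropy; put $F_+(\widehat V,\widehat\phi)=\widehat V/P_{alg}(\widehat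 V,\widehat\phi)$. There is a topological isomorphism of flows $$(P_{top}(V,\phi),\overline\phi^t)\cong(V/P_{alg}(\widehat V,\widehat\phi)^\perp,\overline\phi^a),$$ where both maps are induced by $\phi$. Moreover there are topological isomorphisms, compatible with the endomorphisms induced by $\phi$ and $\widehat\phi$, $$D_+(V,\phi)\cong P_{alg}(\widehat V,\widehat\phi)^\perp\qquad\text{and}\qquad\widehat{D_+(V,\phi)}\cong F_+(\widehat V,\widehat\phi),$$ and $\mathrm{ent}^*(V,\phi)\gg0$ if and only if $\mathrm{ent}(\widehat V,\widehat\phi)\gg0$. -/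

import Mathlib

open Filter
open scoped ENNReal

/-! ### Linearly compact vector spaces -/

/-- Every family of closed linear varieties with the finite intersection property has a common
point. A Hausdorff, linearly topologized space with this property is linearly compact.
(Being Hausdorff and being linearly topologized are the separate classes `T2Space V` and
`IsLinearTopology K V`; both pass to linear subspaces.) -/
class LinearlyCompact (K V : Type*) [Field K] [AddCommGroup V] [Module K V]
    [TopologicalSpace V] : Prop where
  fip : ∀ S : Set (AffineSubspace K V), (∀ s ∈ S, IsClosed (s : Set V)) →
    (∀ T ⊆ S, T.Finite → (⋂ s ∈ T, (s : Set V)).Nonempty) →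
    (⋂ s ∈ S, (s : Set V)).Nonempty

/-- Linear compactness passes to continuous linear images. -/
theorem LinearlyCompact.of_surjective {K V W : Type*} [Field K]
    [AddCommGroup V] [Module K V] [TopologicalSpace V]
    [AddCommGroup W] [Module K W] [TopologicalSpace W]
    (hV : LinearlyCompact K V) (f : V →L[K] W) (hf : Function.Surjective f) :
    LinearlyCompact K W := by
  refine ⟨fun S hcl hfin => ?_⟩
  let g : AffineSubspace K W → AffineSubspace K V :=
    fun s => s.comap (f : V →ₗ[K] W).toAffineMap
  have hg : ∀ (s : AffineSubspace K W) (x : V), x ∈ (g s : Set V) ↔ f x ∈ (s : Set W) :=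
    fun s x => Iff.rfl
  obtain ⟨x, hx⟩ := hV.fip (g '' S) (by
      rintro _ ⟨s, hs, rfl⟩
      exact (hcl s hs).preimage f.continuous) (by
      intro T hT hTfin
      obtain ⟨T', hT'S, hT'fin, rfl⟩ :
          ∃ T' ⊆ S, T'.Finite ∧ T = g '' T' :=
        Set.exists_subset_image_finite_and.1 ⟨T, hT, hTfin, rfl⟩
      obtain ⟨y, hy⟩ := hfin T' hT'S hT'fin
      obtain ⟨x, rfl⟩ := hf y
      refine ⟨x, ?_⟩
      simp only [Set.mem_iInter] at hy ⊢
      rintro _ ⟨s, hs, rfl⟩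
      exact hy s hs)
  refine ⟨f x, ?_⟩
  simp only [Set.mem_iInter] at hx ⊢
  exact fun s hs => hx (g s) ⟨s, hs, rfl⟩

/-! ### Flows: subflows, factors, isomorphisms, entropy

A flow is a topological vector space `V` with a continuous endomorphism `φ : V →L[K] V`. -/

section Flow

variable {K V W : Type*} [Field K]
  [AddCommGroup V] [Module K V] [TopologicalSpace V]
  [AddCommGroup W] [Module K W] [TopologicalSpace W]

/-- The flows `(V, φ)` and `(W, ψ)` are topologically isomorphic. -/
def FlowIso (φ : V →L[K] V) (ψ : W →L[K] W) : Prop :=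
  ∃ e : V ≃L[K] W, ∀ x, e (φ x) = ψ (e x)

/-- `Z` is a `φ`-invariant linear subspace: `φ Z ≤ Z`. -/
def FlowInvariant (φ : V →L[K] V) (Z : Submodule K V) : Prop :=
  ∀ x ∈ Z, φ x ∈ Z

/-- The restriction of `φ` to an invariant subspace. -/
def subflow (φ : V →L[K] V) (Z : Submodule K V) (hZ : FlowInvariant φ Z) : Z →L[K] Z :=
  φ.restrict hZ

/-- The endomorphism induced by `φ` on the quotient by an invariant subspace. -/
def quotientFlow (φ : V →L[K] V) (Z : Submodule K V) (hZ : FlowInvariant φ Z) :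
    (V ⧸ Z) →L[K] (V ⧸ Z) :=
  Z.liftQL (Z.mkQL ∘L φ) fun x hx => by
    simpa using hZ x hx

variable (K V) in
/-- The set of linearly compact open linear subspaces of `V`. -/
def lcOpens : Set (Submodule K V) :=
  {U | IsOpen (U : Set V) ∧ LinearlyCompact K U}

/-- The partial cotrajectory `U ∩ φ⁻¹ U ∩ ⋯ ∩ φ⁻ⁿ⁺¹ U`. -/
def cotrajectory (φ : V →L[K] V) (U : Submodule K V) (n : ℕ) : Submodule K V :=
  ⨅ i ∈ Finset.range n, U.comap ((φ : V →ₗ[K] V) ^ i)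

/-- The partial trajectory `U + φ U + ⋯ + φⁿ⁻¹ U`. -/
def trajectory (φ : V →L[K] V) (U : Submodule K V) (n : ℕ) : Submodule K V :=
  ⨆ i ∈ Finset.range n, U.map ((φ : V →ₗ[K] V) ^ i)

/-- `H*(φ, U) = lim (1/n) dim (U / (U ∩ φ⁻¹ U ∩ ⋯ ∩ φ⁻ⁿ⁺¹ U))`. For `U` open and linearly compact
the dimensions are finite and the limit exists. -/
noncomputable def topEntropyAt (φ : V →L[K] V) (U : Submodule K V) : ℝ≥0∞ :=
  limUnder atTop fun n : ℕ =>
    (Module.finrank K (U ⧸ (cotrajectory φ U n).submoduleOf U) : ℝ≥0∞) / n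

/-- `H(φ, U) = lim (1/n) dim ((U + φ U + ⋯ + φⁿ⁻¹ U) / U)`. For `U` open and linearly compact
the dimensions are finite and the limit exists. -/
noncomputable def algEntropyAt (φ : V →L[K] V) (U : Submodule K V) : ℝ≥0∞ :=
  limUnder atTop fun n : ℕ =>
    (Module.finrank K (trajectory φ U n ⧸ U.submoduleOf (trajectory φ U n)) : ℝ≥0∞) / n

/-- The topological entropy `ent*(V, φ)`. -/
noncomputable def topEntropy (φ : V →L[K] V) : ℝ≥0∞ :=
  ⨆ U ∈ lcOpens K V, topEntropyAt φ U

/-- The algebraic entropy `ent(V, φ)`. -/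
noncomputable def algEntropy (φ : V →L[K] V) : ℝ≥0∞ :=
  ⨆ U ∈ lcOpens K V, algEntropyAt φ U

/-- Completely positive topological entropy: every factor by a proper closed invariant subspace
has nonzero topological entropy. -/
def CPTopEntropy (φ : V →L[K] V) : Prop :=
  ∀ (Z : Submodule K V) (hZ : FlowInvariant φ Z), IsClosed (Z : Set V) → Z ≠ ⊤ →
    topEntropy (quotientFlow φ Z hZ) ≠ 0

/-- Completely positive algebraic entropy (used for discrete `V`): every nonzero invariant
subspace has nonzero algebraic entropy. -/
def CPAlgEntropy (φ : V →L[K] V) : Prop :=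
  ∀ (Z : Submodule K V) (hZ : FlowInvariant φ Z), Z ≠ ⊥ → algEntropy (subflow φ Z hZ) ≠ 0

theorem flowInvariant_sSup {φ : V →L[K] V} {S : Set (Submodule K V)}
    (h : ∀ Z ∈ S, FlowInvariant φ Z) : FlowInvariant φ (sSup S) := by
  have : sSup S ≤ (sSup S).comap (φ : V →ₗ[K] V) :=
    sSup_le fun Z hZ x hx => (le_sSup hZ : Z ≤ sSup S) (h Z hZ x hx)
  exact this

/-! ### Pinsker constructions -/

/-- The closed invariant subspaces of completely positive topological entropy. -/
def cpTopSubspaces (φ : V →L[K] V) : Set (Submodule K V) :=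
  {Z | IsClosed (Z : Set V) ∧ ∃ hZ : FlowInvariant φ Z, CPTopEntropy (subflow φ Z hZ)}

/-- The closed invariant subspaces whose factor has zero topological entropy. -/
def zeroTopFactorKernels (φ : V →L[K] V) : Set (Submodule K V) :=
  {Z | IsClosed (Z : Set V) ∧ ∃ hZ : FlowInvariant φ Z, topEntropy (quotientFlow φ Z hZ) = 0}

/-- The invariant subspaces of zero algebraic entropy. -/
def zeroAlgSubspaces (φ : V →L[K] V) : Set (Submodule K V) :=
  {Z | ∃ hZ : FlowInvariant φ Z, algEntropy (subflow φ Z hZ) = 0}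

/-- The invariant subspaces whose factor has completely positive algebraic entropy. -/
def cpAlgFactorKernels (φ : V →L[K] V) : Set (Submodule K V) :=
  {Z | ∃ hZ : FlowInvariant φ Z, CPAlgEntropy (quotientFlow φ Z hZ)}

/-- The domain of completely positive topological entropy `D₊(V, φ)`. -/
def domainCP (φ : V →L[K] V) : Submodule K V :=
  sSup (cpTopSubspaces φ)

theorem domainCP_invariant (φ : V →L[K] V) : FlowInvariant φ (domainCP φ) :=
  flowInvariant_sSup fun _ hZ => hZ.2.1

/-- The Pinsker subspace `P_alg(V, φ)`. -/
noncomputable def pinskerSubspace (φ : V →L[K] V) : Submodule K V :=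
  sSup (zeroAlgSubspaces φ)

theorem pinskerSubspace_invariant (φ : V →L[K] V) : FlowInvariant φ (pinskerSubspace φ) :=
  flowInvariant_sSup fun _ hZ => hZ.1

/-- The endomorphism `φ̄ᵗ` of the Pinsker factor `P_top(V, φ) = V / D₊(V, φ)`. -/
def pinskerFactorMap (φ : V →L[K] V) : (V ⧸ domainCP φ) →L[K] (V ⧸ domainCP φ) :=
  quotientFlow φ (domainCP φ) (domainCP_invariant φ)

/-- The endomorphism induced on the factor of completely positive algebraic entropy
`F₊(V, φ) = V / P_alg(V, φ)`. -/
noncomputable def factorCPMap (φ : V →L[K] V) :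
    (V ⧸ pinskerSubspace φ) →L[K] (V ⧸ pinskerSubspace φ) :=
  quotientFlow φ (pinskerSubspace φ) (pinskerSubspace_invariant φ)

end Flow

/-! ### Lefschetz duality -/

section Dual

variable (K V : Type*) [Field K] [TopologicalSpace K] [DiscreteTopology K]
  [AddCommGroup V] [Module K V] [TopologicalSpace V]

/-- The space of continuous linear forms on `V`, with the topology defined below. -/
def LefschetzDual : Type _ := V →L[K] K

namespace LefschetzDual

noncomputable instance : AddCommGroup (LefschetzDual K V) :=
  inferInstanceAs (AddCommGroup (V →L[K] K))

noncomputable instance : Module K (LefschetzDual K V) :=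
  inferInstanceAs (Module K (V →L[K] K))

instance : FunLike (LefschetzDual K V) V K :=
  inferInstanceAs (FunLike (V →L[K] K) V K)

/-- The (linearly compact)-open topology: the coarsest topology for which, for every linearly
compact subspace `A`, the restriction `χ ↦ χ|_A` to the discrete space of functions `A → K` is
continuous. Equivalently, it is the group topology in which the annihilators of the linearly
compact subspaces form a neighbourhood basis at `0`. -/
instance : TopologicalSpace (LefschetzDual K V) :=
  ⨅ (A : Submodule K V) (_ : LinearlyCompact K A),
    TopologicalSpace.induced (fun χ (a : A) => χ (a : V)) ⊥

variable {K V}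

/-- The dual endomorphism `χ ↦ χ ∘ φ`. -/
noncomputable def map (φ : V →L[K] V) : LefschetzDual K V →L[K] LefschetzDual K V where
  toFun χ := (show V →L[K] K from χ) ∘L φ
  map_add' _ _ := rfl
  map_smul' _ _ := rfl
  cont := by
    refine continuous_iInf_rng.2 fun A => continuous_iInf_rng.2 fun hA => ?_
    have hB : LinearlyCompact K (A.map (φ : V →ₗ[K] V)) := by
      refine hA.of_surjective
        (φ.restrict (q := A.map (φ : V →ₗ[K] V)) fun x hx => ⟨x, hx, rfl⟩) ?_
      rintro ⟨_, x, hx, rfl⟩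
      exact ⟨⟨x, hx⟩, rfl⟩
    refine continuous_iInf_dom (i := A.map (φ : V →ₗ[K] V)) (continuous_iInf_dom (i := hB) ?_)
    refine continuous_induced_rng.2 ?_
    let r : (A.map (φ : V →ₗ[K] V) → K) → (A → K) := fun h a => h ⟨φ a, a, a.2, rfl⟩
    let res : LefschetzDual K V → (A.map (φ : V →ₗ[K] V) → K) := fun χ b => χ (b : V)
    exact @Continuous.comp _ _ _ (TopologicalSpace.induced res ⊥) ⊥ ⊥ res r
      continuous_bot (@continuous_induced_dom _ _ res ⊥)

@[simp]
theorem map_apply (φ : V →L[K] V) (χ : LefschetzDual K V) (v : V) : map φ χ v = χ (φ v) :=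
  rfl

/-- The annihilator in `V` of a subspace of the dual of `V` (`V` is identified with its bidual). -/
def perp (P : Submodule K (LefschetzDual K V)) : Submodule K V where
  carrier := {v | ∀ χ ∈ P, χ v = 0}
  add_mem' {a b} ha hb χ hχ := by
    have h : χ (a + b) = χ a + χ b := map_add (show V →L[K] K from χ) a b
    rw [h, ha χ hχ, hb χ hχ, add_zero]
  zero_mem' χ _ := map_zero (show V →L[K] K from χ)
  smul_mem' c x hx χ hχ := by
    have h : χ (c • x) = c • χ x := map_smul (show V →L[K] K from χ) c x
    rw [h, hx χ hχ, smul_zero]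

theorem perp_invariant {φ : V →L[K] V} {P : Submodule K (LefschetzDual K V)}
    (hP : FlowInvariant (map φ) P) : FlowInvariant φ (perp P) :=
  fun _ hv χ hχ => hv (map φ χ) (hP χ hχ)

/-- The subspace `P_alg(V̂, φ̂)^⊥` of `V`. -/
noncomputable def pinskerPerp (φ : V →L[K] V) : Submodule K V :=
  perp (pinskerSubspace (map φ))

theorem pinskerPerp_invariant (φ : V →L[K] V) : FlowInvariant φ (pinskerPerp φ) :=
  perp_invariant (pinskerSubspace_invariant _)

end LefschetzDual

end Dual

open Polynomial Topology

/-! ### Torsion of an endomorphism, with `V` viewed as a `K[X]`-module -/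

section Algebra

variable {K V W : Type*} [Field K] [AddCommGroup V] [Module K V] [AddCommGroup W] [Module K W]

/-! View a discrete flow as a `K[X]`-module. A non-torsion vector spans a copy of `K[X]`, whose
trajectories grow by one dimension per step and give entropy 1; torsion vectors generate
finite-dimensional invariant subspaces, which contribute nothing. So zero algebraic entropy means
torsion, completely positive entropy means torsion-free, and the Pinsker subspace is the torsion
submodule (`algEntropy_eq_zero_iff`, `cpAlgEntropy_iff`).

The topological side is carried over by duality. For linearly compact `V` the dual is discrete,
annihilators match the closed subspaces of `V` with all subspaces of the dual
(`perp_annihilator_of_isClosed`, `annihilator_perp`), and trajectories of finite-dimensional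
subspaces correspond to cotrajectories of open ones. Hence `ent*` of the flow equals `ent` of its
dual (`topEntropy_eq_algEntropy_map`). The dual of a factor `V/Z` is the annihilator of `Z`, and the
dual of a closed subspace is the quotient by its annihilator. Therefore `D₊` is exactly the
annihilator in `V` of the torsion of the dual, and every claim becomes one about torsion. -/

theorem aeval_apply_of_intertwines {f : Module.End K V} {g : Module.End K W} (T : V →ₗ[K] W)
    (h : ∀ x, T (f x) = g (T x)) (p : K[X]) (x : V) : T (aeval f p x) = aeval g p (T x) := by
  have hpow : ∀ (n : ℕ) (x : V), T ((f ^ n) x) = (g ^ n) (T x) := by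
    intro n
    induction n with
    | zero => simp
    | succ n ih => intro x; rw [pow_succ, pow_succ, Module.End.mul_apply, ih, h]; rfl
  induction p using Polynomial.induction_on' with
  | add p q hp hq => simp [hp, hq]
  | monomial n a => simp [aeval_monomial, Module.algebraMap_end_apply, hpow]

/-- The vectors annihilated by a nonzero polynomial in the endomorphism `f`. -/
noncomputable def polyTorsion (f : Module.End K V) : Submodule K V where
  carrier := {v | ∃ p : K[X], p ≠ 0 ∧ aeval f p v = 0}
  add_mem' := by
    rintro a b ⟨p, hp, ha⟩ ⟨q, hq, hb⟩
    refine ⟨p * q, mul_ne_zero hp hq, ?_⟩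
    rw [map_add]
    have h1 : aeval f (p * q) a = 0 := by rw [mul_comm]; simp [ha]
    have h2 : aeval f (p * q) b = 0 := by simp [hb]
    rw [h1, h2, add_zero]
  zero_mem' := ⟨1, one_ne_zero, by simp⟩
  smul_mem' := by
    rintro c x ⟨p, hp, hx⟩
    exact ⟨p, hp, by rw [map_smul, hx, smul_zero]⟩

theorem map_mem_polyTorsion {f : Module.End K V} {g : Module.End K W} (T : V →ₗ[K] W)
    (h : ∀ x, T (f x) = g (T x)) {x : V} (hx : x ∈ polyTorsion f) : T x ∈ polyTorsion g := by
  obtain ⟨p, hp, hpx⟩ := hx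
  exact ⟨p, hp, by rw [← aeval_apply_of_intertwines T h, hpx, map_zero]⟩

theorem map_mem_polyTorsion_iff {f : Module.End K V} {g : Module.End K W} {T : V →ₗ[K] W}
    (hT : Function.Injective T) (h : ∀ x, T (f x) = g (T x)) {x : V} :
    T x ∈ polyTorsion g ↔ x ∈ polyTorsion f := by
  refine ⟨?_, map_mem_polyTorsion T h⟩
  rintro ⟨p, hp, hpx⟩
  exact ⟨p, hp, hT (by rw [aeval_apply_of_intertwines T h, hpx, map_zero])⟩

/-- A vector is torsion as soon as some nonzero polynomial maps it to a torsion vector. -/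
theorem mem_polyTorsion_of_aeval {f : Module.End K V} {v : V} {p : K[X]} (hp : p ≠ 0)
    (h : aeval f p v ∈ polyTorsion f) : v ∈ polyTorsion f := by
  obtain ⟨q, hq, hqv⟩ := h
  exact ⟨q * p, mul_ne_zero hq hp, by simpa using hqv⟩

/-- Evaluation `p ↦ p(f) v`, whose range is the `f`-invariant subspace generated by `v`. -/
noncomputable def cyclicMap (f : Module.End K V) (v : V) : K[X] →ₗ[K] V :=
  (LinearMap.applyₗ v) ∘ₗ (aeval f).toLinearMap

theorem cyclicMap_apply (f : Module.End K V) (v : V) (p : K[X]) :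
    cyclicMap f v p = aeval f p v := rfl

/-- Division with remainder by an annihilating `p`: polynomials of degree below `deg p` already
produce the whole range. -/
theorem finite_range_cyclicMap {f : Module.End K V} {v : V} (hv : v ∈ polyTorsion f) :
    Module.Finite K (cyclicMap f v).range := by
  obtain ⟨p, hp, hpv⟩ := hv
  have hfin : Module.Finite K (degreeLT K p.natDegree) :=
    Module.Finite.equiv (degreeLTEquiv K p.natDegree).symm
  have hle : (cyclicMap f v).range ≤ (degreeLT K p.natDegree).map (cyclicMap f v) := by
    rintro _ ⟨q, rfl⟩
    refine ⟨q % p, ?_, ?_⟩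
    · rw [SetLike.mem_coe, mem_degreeLT, ← degree_eq_natDegree hp]
      exact EuclideanDomain.mod_lt q hp
    · conv_rhs => rw [← EuclideanDomain.mod_add_div q p, mul_comm p]
      simp [cyclicMap_apply, hpv]
  exact Submodule.finiteDimensional_of_le hle

theorem cyclicMap_injective {f : Module.End K V} {v : V} (hv : v ∉ polyTorsion f) :
    Function.Injective (cyclicMap f v) := by
  rw [← LinearMap.ker_eq_bot, LinearMap.ker_eq_bot']
  intro p hp
  by_contra h
  exact hv ⟨p, h, hp⟩

end Algebra

/-! ### Linear compactness: closed subspaces, quotients, the discrete case -/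

section LC

variable {K V : Type*} [Field K] [AddCommGroup V] [Module K V] [TopologicalSpace V]

theorem LinearlyCompact.of_isClosed (hV : LinearlyCompact K V) {Z : Submodule K V}
    (hZ : IsClosed (Z : Set V)) : LinearlyCompact K Z := by
  refine ⟨fun S hcl hfin => ?_⟩
  let g : AffineSubspace K Z → AffineSubspace K V := fun s => s.map Z.subtype.toAffineMap
  have hg : ∀ s, (g s : Set V) = Subtype.val '' (s : Set Z) := fun s => rfl
  -- Adjoining `⊤`, that is `Z` itself, forces the common point into `Z` even when `S` is empty.
  have hne : (⋂ s ∈ insert ⊤ S, (g s : Set V)).Nonempty := by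
    have := hV.fip (g '' (insert ⊤ S)) (by
      rintro _ ⟨s, hs, rfl⟩
      rw [hg]
      refine (hZ.isClosedEmbedding_subtypeVal).isClosedMap _ ?_
      rcases hs with rfl | hs
      · simp
      · exact hcl s hs) (by
      intro T hT hTfin
      obtain ⟨T', hT'S, hT'fin, rfl⟩ : ∃ T' ⊆ insert ⊤ S, T'.Finite ∧ T = g '' T' :=
        Set.exists_subset_image_finite_and.1 ⟨T, hT, hTfin, rfl⟩
      obtain ⟨y, hy⟩ := hfin (T' ∩ S) Set.inter_subset_right (hT'fin.inter_of_left _)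
      refine ⟨y, ?_⟩
      simp only [Set.mem_iInter] at hy ⊢
      rintro _ ⟨s, hs, rfl⟩
      rw [hg]
      refine ⟨y, ?_, rfl⟩
      rcases hT'S hs with rfl | h
      · trivial
      · exact hy s ⟨hs, h⟩)
    rwa [Set.biInter_image] at this
  obtain ⟨x, hx⟩ := hne
  simp only [Set.mem_iInter] at hx
  have hxZ : x ∈ Z := by
    obtain ⟨y, -, rfl⟩ := hx ⊤ (Set.mem_insert _ _)
    exact y.2
  refine ⟨⟨x, hxZ⟩, ?_⟩
  simp only [Set.mem_iInter]
  intro s hs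
  obtain ⟨y, hy, rfl⟩ := hx s (Set.mem_insert_of_mem _ hs)
  exact hy

/-- Choose a finite subfamily whose intersection has minimal direction. Adding any further member
cannot shrink that nonempty intersection, so each of its points lies in every member. -/
theorem LinearlyCompact.of_finite [Module.Finite K V] : LinearlyCompact K V := by
  refine ⟨fun S _ hfin => ?_⟩
  let D : Set (Submodule K V) := {d | ∃ T ⊆ S, T.Finite ∧ d = (sInf T).direction}
  obtain ⟨d, ⟨T, hTS, hT, rfl⟩, hmin⟩ :=
    WellFounded.has_min (wellFounded_lt (α := Submodule K V)) D
      ⟨_, ∅, Set.empty_subset _, Set.finite_empty, rfl⟩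
  obtain ⟨x, hx⟩ := hfin T hTS hT
  refine ⟨x, ?_⟩
  simp only [Set.mem_iInter] at hx ⊢
  intro s hs
  have hle : sInf (insert s T) ≤ sInf T := sInf_le_sInf (Set.subset_insert _ _)
  have hins : insert s T ⊆ S := Set.insert_subset hs hTS
  have hdir : (sInf (insert s T)).direction = (sInf T).direction := by
    by_contra hne
    exact hmin _ ⟨_, hins, hT.insert s, rfl⟩
      (lt_of_le_of_ne (AffineSubspace.direction_le hle) hne)
  have hnon : ((sInf (insert s T) : AffineSubspace K V) : Set V).Nonempty := by
    obtain ⟨y, hy⟩ := hfin _ hins (hT.insert s)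
    refine ⟨y, (AffineSubspace.mem_sInf_iff _ _).2 ?_⟩
    simpa using hy
  have heq := AffineSubspace.eq_of_direction_eq_of_nonempty_of_le hdir hnon hle
  have hxT : x ∈ sInf T := (AffineSubspace.mem_sInf_iff _ _).2 hx
  rw [← heq] at hxT
  exact (AffineSubspace.mem_sInf_iff _ _).1 hxT s (Set.mem_insert _ _)

/-- The hyperplanes "coordinate `i` equals 1" for a basis have the finite intersection property, by
finite sums of basis vectors. A common point has every coordinate 1, and its finite support forces a
finite basis. -/
theorem LinearlyCompact.finite_of_discrete [DiscreteTopology V] (hV : LinearlyCompact K V) :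
    Module.Finite K V := by
  let b := Module.Basis.ofVectorSpace K V
  let H : Module.Basis.ofVectorSpaceIndex K V → AffineSubspace K V := fun i =>
    (AffineSubspace.mk' (1 : K) ⊥).comap (b.coord i).toAffineMap
  have hH : ∀ i x, x ∈ (H i : Set V) ↔ b.repr x i = 1 := by
    intro i x
    change x ∈ (AffineSubspace.mk' (1 : K) ⊥).comap (b.coord i).toAffineMap ↔ _
    rw [AffineSubspace.mem_comap, AffineSubspace.mem_mk']
    simp [sub_eq_zero]
  obtain ⟨x, hx⟩ := hV.fip (Set.range H) (fun _ _ => isClosed_discrete _) (by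
    intro T hT hTfin
    obtain ⟨T', -, hT'fin, rfl⟩ : ∃ T' ⊆ Set.univ, T'.Finite ∧ T = H '' T' :=
      Set.exists_subset_image_finite_and.1 ⟨T, by simpa using hT, hTfin, rfl⟩
    refine ⟨∑ i ∈ hT'fin.toFinset, b i, ?_⟩
    simp only [Set.mem_iInter]
    rintro _ ⟨i, hi, rfl⟩
    rw [hH]
    classical
    simp [Finsupp.single_apply, hi])
  simp only [Set.mem_iInter] at hx
  have hfin : Finite (Module.Basis.ofVectorSpaceIndex K V) := by
    have : (Set.univ : Set (Module.Basis.ofVectorSpaceIndex K V)) ⊆ (b.repr x).support := by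
      intro i _
      have := (hH i x).1 (hx _ ⟨i, rfl⟩)
      simp [this]
    exact Set.finite_univ_iff.1 ((b.repr x).support.finite_toSet.subset this)
  exact Module.Finite.of_basis b

theorem Submodule.isClosed_of_isOpen [IsTopologicalAddGroup V] {U : Submodule K V}
    (h : IsOpen (U : Set V)) : IsClosed (U : Set V) :=
  U.toAddSubgroup.isClosed_of_isOpen h

theorem Submodule.discreteTopology_quotient [IsTopologicalAddGroup V] {U : Submodule K V}
    (h : IsOpen (U : Set V)) : DiscreteTopology (V ⧸ U) :=
  QuotientAddGroup.discreteTopology (N := U.toAddSubgroup) h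

theorem Submodule.isLinearTopology [IsLinearTopology K V] (Z : Submodule K V) :
    IsLinearTopology K Z := by
  refine IsLinearTopology.mk_of_hasBasis (S := Submodule K Z) K
    (p := fun N : Submodule K V => (N : Set V) ∈ 𝓝 0)
    (s := fun N : Submodule K V => N.submoduleOf Z) ?_
  have := (IsLinearTopology.hasBasis_submodule K (M := V)).comap (Subtype.val : Z → V)
  rw [nhds_subtype_eq_comap]
  exact this

theorem mem_lcOpens_iff_isOpen [IsTopologicalAddGroup V] (hV : LinearlyCompact K V)
    {U : Submodule K V} : U ∈ lcOpens K V ↔ IsOpen (U : Set V) :=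
  ⟨fun h => h.1, fun h => ⟨h, hV.of_isClosed (Submodule.isClosed_of_isOpen h)⟩⟩

theorem mem_lcOpens_iff_finite [DiscreteTopology V] {F : Submodule K V} :
    F ∈ lcOpens K V ↔ Module.Finite K F :=
  ⟨fun h => h.2.finite_of_discrete, fun _ => ⟨isOpen_discrete _, LinearlyCompact.of_finite⟩⟩

theorem LinearlyCompact.finite_quotient [IsTopologicalAddGroup V] (hV : LinearlyCompact K V)
    {U : Submodule K V} (h : IsOpen (U : Set V)) : Module.Finite K (V ⧸ U) :=
  have := Submodule.discreteTopology_quotient h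
  (hV.of_surjective U.mkQL U.mkQ_surjective).finite_of_discrete

theorem LinearlyCompact.quotient (hV : LinearlyCompact K V) (Z : Submodule K V) :
    LinearlyCompact K (V ⧸ Z) :=
  hV.of_surjective Z.mkQL Z.mkQ_surjective

end LC

/-! ### Dimension counts for nested subspaces -/

section Finrank

variable {K V : Type*} [Field K] [AddCommGroup V] [Module K V]

theorem finrank_quotient_submoduleOf {F T : Submodule K V} [Module.Finite K T] (h : F ≤ T) :
    Module.finrank K (T ⧸ F.submoduleOf T) + Module.finrank K F = Module.finrank K T := by
  rw [← (Submodule.submoduleOfEquivOfLe h).finrank_eq]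
  exact Submodule.finrank_quotient_add_finrank _

theorem finrank_quotient_submoduleOf_add {C U : Submodule K V} [Module.Finite K (V ⧸ C)]
    (h : C ≤ U) :
    Module.finrank K (U ⧸ C.submoduleOf U) + Module.finrank K (V ⧸ U) =
      Module.finrank K (V ⧸ C) := by
  have e : (U ⧸ C.submoduleOf U) ≃ₗ[K] U.map C.mkQ := by
    have hk : (C.mkQ ∘ₗ U.subtype).ker = C.submoduleOf U := by
      rw [LinearMap.ker_comp, Submodule.ker_mkQ]; rfl
    have hr : (C.mkQ ∘ₗ U.subtype).range = U.map C.mkQ := by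
      rw [LinearMap.range_comp, Submodule.range_subtype]
    exact (Submodule.quotEquivOfEq _ _ hk.symm).trans
      ((LinearMap.quotKerEquivRange _).trans (LinearEquiv.ofEq _ _ hr))
  rw [e.finrank_eq, ← (Submodule.quotientQuotientEquivQuotient C U h).finrank_eq, add_comm]
  exact Submodule.finrank_quotient_add_finrank _

end Finrank

/-! ### Algebraic entropy of discrete flows and torsion -/

section Trajectory

variable {K V : Type*} [Field K] [AddCommGroup V] [Module K V] [TopologicalSpace V]

theorem trajectory_le {φ : V →L[K] V} {F G : Submodule K V} {n : ℕ} :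
    trajectory φ F n ≤ G ↔ ∀ i < n, ∀ x ∈ F, ((φ : V →ₗ[K] V) ^ i) x ∈ G := by
  simp only [trajectory, iSup_le_iff, Finset.mem_range, Submodule.map_le_iff_le_comap]
  rfl

theorem mem_cotrajectory {φ : V →L[K] V} {U : Submodule K V} {n : ℕ} {x : V} :
    x ∈ cotrajectory φ U n ↔ ∀ i < n, ((φ : V →ₗ[K] V) ^ i) x ∈ U := by
  simp [cotrajectory, Submodule.mem_iInf]

theorem le_trajectory (φ : V →L[K] V) (F : Submodule K V) {n : ℕ} (hn : n ≠ 0) :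
    F ≤ trajectory φ F n :=
  fun x hx => trajectory_le.1 le_rfl 0 (Nat.pos_of_ne_zero hn) x hx

theorem cotrajectory_le (φ : V →L[K] V) (U : Submodule K V) {n : ℕ} (hn : n ≠ 0) :
    cotrajectory φ U n ≤ U :=
  fun _ hx => mem_cotrajectory.1 hx 0 (Nat.pos_of_ne_zero hn)

theorem finite_trajectory (φ : V →L[K] V) (F : Submodule K V) [Module.Finite K F] (n : ℕ) :
    Module.Finite K (trajectory φ F n) := by
  rw [trajectory, ← Finset.sup_eq_iSup]
  infer_instance

theorem trajectory_span_singleton (φ : V →L[K] V) (v : V) (n : ℕ) :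
    trajectory φ (Submodule.span K {v}) n =
      (degreeLT K n).map (cyclicMap (φ : V →ₗ[K] V) v) := by
  apply le_antisymm
  · rw [trajectory_le]
    intro i hi x hx
    obtain ⟨c, rfl⟩ := Submodule.mem_span_singleton.1 hx
    refine ⟨C c * X ^ i, ?_, by simp [cyclicMap_apply]⟩
    rw [SetLike.mem_coe, mem_degreeLT]
    exact lt_of_le_of_lt (degree_C_mul_X_pow_le i c) (by exact_mod_cast hi)
  · classical
    rw [degreeLT_eq_span_X_pow, Submodule.map_span, Submodule.span_le]
    rintro _ ⟨_, hp, rfl⟩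
    simp only [Finset.coe_image, Set.mem_image, Finset.coe_range, Set.mem_Iio] at hp
    obtain ⟨i, hi, rfl⟩ := hp
    have := trajectory_le.1 (le_refl (trajectory φ (Submodule.span K {v}) n)) i hi v
      (Submodule.mem_span_singleton_self v)
    simpa [cyclicMap_apply] using this

/-- The growth rate of a non-torsion line: its `n`-th trajectory has dimension `n`, and the line
itself is divided out. -/
theorem tendsto_natCast_sub_one_div :
    Tendsto (fun n : ℕ => ((n - 1 : ℕ) : ℝ≥0∞) / n) atTop (𝓝 1) := by
  have h : Tendsto (fun n : ℕ => (1 : ℝ≥0∞) - (n : ℝ≥0∞)⁻¹) atTop (𝓝 (1 - 0)) :=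
    ENNReal.Tendsto.sub tendsto_const_nhds ENNReal.tendsto_inv_nat_nhds_zero (by simp)
  rw [tsub_zero] at h
  refine h.congr' ?_
  filter_upwards [eventually_ge_atTop 1] with n hn
  have hn0 : (n : ℝ≥0∞) ≠ 0 := by exact_mod_cast (by lia : n ≠ 0)
  rw [ENNReal.natCast_sub, ENNReal.sub_div (fun _ _ => hn0),
    ENNReal.div_self hn0 (ENNReal.natCast_ne_top n)]
  simp

theorem algEntropyAt_span_singleton {φ : V →L[K] V} {v : V}
    (hv : v ∉ polyTorsion (φ : V →ₗ[K] V)) :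
    algEntropyAt φ (Submodule.span K {v}) = 1 := by
  refine Tendsto.limUnder_eq (tendsto_natCast_sub_one_div.congr' ?_)
  filter_upwards [eventually_ge_atTop 1] with n hn
  have hv0 : v ≠ 0 := fun h => hv (h ▸ zero_mem _)
  have := finite_trajectory φ (Submodule.span K {v}) n
  have h1 := finrank_quotient_submoduleOf (le_trajectory φ (Submodule.span K {v}) (by lia : n ≠ 0))
  have h2 : Module.finrank K (trajectory φ (Submodule.span K {v}) n) = n := by
    rw [trajectory_span_singleton,
      ← (Submodule.equivMapOfInjective _ (cyclicMap_injective hv) _).finrank_eq,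
      (degreeLTEquiv K n).finrank_eq]
    simp
  rw [finrank_span_singleton hv0, h2] at h1
  congr 2
  lia

/-- Finitely many torsion vectors generate a finite-dimensional invariant subspace `G` that contains
all trajectories, so the dimensions stay bounded. -/
theorem algEntropyAt_eq_zero {φ : V →L[K] V} {F : Submodule K V} [Module.Finite K F]
    (hF : F ≤ polyTorsion (φ : V →ₗ[K] V)) : algEntropyAt φ F = 0 := by
  obtain ⟨s, hs⟩ := (Module.Finite.iff_fg.1 ‹Module.Finite K F›)
  let G : Submodule K V := s.sup fun v => (cyclicMap (φ : V →ₗ[K] V) v).range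
  have hfin : Module.Finite K G := by
    refine Finset.sup_induction (p := fun G : Submodule K V => Module.Finite K G)
      inferInstance (fun a ha b hb => ?_) (fun v hv => ?_)
    · have := ha; have := hb; infer_instance
    · exact finite_range_cyclicMap (hF (hs ▸ Submodule.subset_span hv))
  have hle : ∀ n, trajectory φ F n ≤ G := by
    intro n
    rw [trajectory_le]
    intro i _
    suffices F ≤ G.comap ((φ : V →ₗ[K] V) ^ i) from this
    rw [← hs, Submodule.span_le]
    intro v hv
    have : (cyclicMap (φ : V →ₗ[K] V) v).range ≤ G :=
      Finset.le_sup (f := fun v => (cyclicMap (φ : V →ₗ[K] V) v).range) hv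
    exact this ⟨X ^ i, by simp [cyclicMap_apply]⟩
  refine Tendsto.limUnder_eq ?_
  have hlim : Tendsto (fun n : ℕ => (Module.finrank K G : ℝ≥0∞) / n) atTop (𝓝 0) :=
    by
    simpa using ENNReal.Tendsto.const_div (a := (Module.finrank K G : ℝ≥0∞))
      ENNReal.tendsto_nat_nhds_top (Or.inr (ENNReal.natCast_ne_top _))
  refine tendsto_of_tendsto_of_tendsto_of_le_of_le tendsto_const_nhds hlim
    (fun _ => zero_le) (fun n => ?_)
  have := finite_trajectory φ F n
  refine ENNReal.div_le_div_right ?_ _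
  exact_mod_cast (Submodule.finrank_quotient_le _).trans (Submodule.finrank_mono (hle n))

/-- A discrete flow has zero algebraic entropy iff every vector is torsion. -/
theorem algEntropy_eq_zero_iff [DiscreteTopology V] {φ : V →L[K] V} :
    algEntropy φ = 0 ↔ polyTorsion (φ : V →ₗ[K] V) = ⊤ := by
  simp only [algEntropy, ENNReal.iSup_eq_zero]
  constructor
  · intro h
    rw [eq_top_iff]
    intro v _
    by_contra hv
    have := h (Submodule.span K {v}) (mem_lcOpens_iff_finite.2 inferInstance)
    rw [algEntropyAt_span_singleton hv] at this
    exact one_ne_zero this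
  · intro h F hF
    have := mem_lcOpens_iff_finite.1 hF
    exact algEntropyAt_eq_zero (h ▸ le_top)

theorem polyTorsion_invariant (φ : V →L[K] V) : FlowInvariant φ (polyTorsion (φ : V →ₗ[K] V)) :=
  fun _ hx => map_mem_polyTorsion (φ : V →ₗ[K] V) (fun _ => rfl) hx

theorem algEntropy_subflow_eq_zero_iff [DiscreteTopology V] {φ : V →L[K] V} {Z : Submodule K V}
    (hZ : FlowInvariant φ Z) :
    algEntropy (subflow φ Z hZ) = 0 ↔ Z ≤ polyTorsion (φ : V →ₗ[K] V) := by
  rw [algEntropy_eq_zero_iff, eq_top_iff]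
  have h : ∀ x : Z, (x : V) ∈ polyTorsion (φ : V →ₗ[K] V) ↔
      x ∈ polyTorsion (subflow φ Z hZ : Z →ₗ[K] Z) := fun x =>
    map_mem_polyTorsion_iff (T := Z.subtype) Subtype.val_injective (fun _ => rfl)
  exact ⟨fun hT x hx => (h ⟨x, hx⟩).2 (hT trivial), fun hT x _ => (h x).1 (hT x.2)⟩

theorem cpAlgEntropy_iff [DiscreteTopology V] {φ : V →L[K] V} :
    CPAlgEntropy φ ↔ polyTorsion (φ : V →ₗ[K] V) = ⊥ := by
  simp only [CPAlgEntropy, ne_eq, algEntropy_subflow_eq_zero_iff]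
  constructor
  · intro h
    by_contra hne
    exact h _ (polyTorsion_invariant φ) hne le_rfl
  · intro h Z _ hne hle
    exact hne (le_bot_iff.1 (h ▸ hle))

theorem isGreatest_polyTorsion [DiscreteTopology V] (φ : V →L[K] V) :
    IsGreatest (zeroAlgSubspaces φ) (polyTorsion (φ : V →ₗ[K] V)) :=
  ⟨⟨polyTorsion_invariant φ, (algEntropy_subflow_eq_zero_iff _).2 le_rfl⟩,
    fun _ ⟨hZ, h⟩ => (algEntropy_subflow_eq_zero_iff hZ).1 h⟩

theorem pinskerSubspace_eq [DiscreteTopology V] (φ : V →L[K] V) :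
    pinskerSubspace φ = polyTorsion (φ : V →ₗ[K] V) :=
  (isGreatest_polyTorsion φ).isLUB.sSup_eq

theorem Submodule.discreteTopology_quotient_of_discrete [DiscreteTopology V]
    (Z : Submodule K V) : DiscreteTopology (V ⧸ Z) :=
  Submodule.discreteTopology_quotient (isOpen_discrete _)

/-- Modulo its torsion a module is torsion-free. Conversely, torsion vectors stay torsion in any
quotient, hence vanish in a torsion-free one. -/
theorem isLeast_polyTorsion [DiscreteTopology V] (φ : V →L[K] V) :
    IsLeast (cpAlgFactorKernels φ) (polyTorsion (φ : V →ₗ[K] V)) := by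
  have key : ∀ (Z : Submodule K V) (hZ : FlowInvariant φ Z) (p : K[X]) (v : V),
      Z.mkQ (aeval (φ : V →ₗ[K] V) p v) =
        aeval (quotientFlow φ Z hZ : (V ⧸ Z) →ₗ[K] (V ⧸ Z)) p (Z.mkQ v) := fun Z hZ =>
    aeval_apply_of_intertwines Z.mkQ fun _ => rfl
  constructor
  · refine ⟨polyTorsion_invariant φ, ?_⟩
    have := (polyTorsion (φ : V →ₗ[K] V)).discreteTopology_quotient_of_discrete
    rw [cpAlgEntropy_iff, eq_bot_iff]
    intro x hx
    obtain ⟨v, rfl⟩ := Submodule.mkQ_surjective _ x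
    obtain ⟨p, hp, hpv⟩ := hx
    rw [← key, Submodule.mkQ_apply, Submodule.Quotient.mk_eq_zero] at hpv
    simpa using mem_polyTorsion_of_aeval hp hpv
  · rintro Z ⟨hZ, h⟩ v hv
    have := Z.discreteTopology_quotient_of_discrete
    rw [cpAlgEntropy_iff] at h
    have : Z.mkQ v ∈ polyTorsion (quotientFlow φ Z hZ : (V ⧸ Z) →ₗ[K] (V ⧸ Z)) :=
      map_mem_polyTorsion Z.mkQ (fun _ => rfl) hv
    rw [h] at this
    simpa using this

end Trajectory

/-! ### Isomorphisms arising from equal subspaces -/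

section FlowCongr

variable {K V : Type*} [Field K] [AddCommGroup V] [Module K V] [TopologicalSpace V]

theorem FlowIso.refl (φ : V →L[K] V) : FlowIso φ φ :=
  ⟨ContinuousLinearEquiv.refl K V, fun _ => rfl⟩

theorem flowIso_subflow_of_eq (φ : V →L[K] V) {Z Z' : Submodule K V} (h : Z = Z')
    (hZ : FlowInvariant φ Z) (hZ' : FlowInvariant φ Z') :
    FlowIso (subflow φ Z hZ) (subflow φ Z' hZ') := by
  subst h
  exact FlowIso.refl _

theorem flowIso_quotientFlow_of_eq (φ : V →L[K] V) {Z Z' : Submodule K V} (h : Z = Z')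
    (hZ : FlowInvariant φ Z) (hZ' : FlowInvariant φ Z') :
    FlowIso (quotientFlow φ Z hZ) (quotientFlow φ Z' hZ') := by
  subst h
  exact FlowIso.refl _

end FlowCongr

/-! ### Annihilators, and the equality of the two entropies -/

namespace LefschetzDual

variable {K V W : Type*} [Field K] [TopologicalSpace K] [DiscreteTopology K]
  [AddCommGroup V] [Module K V] [TopologicalSpace V]
  [AddCommGroup W] [Module K W] [TopologicalSpace W]

/-- The inclusion of the continuous linear forms into all linear forms. -/
noncomputable def toDual : LefschetzDual K V →ₗ[K] Module.Dual K V where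
  toFun χ := ((show V →L[K] K from χ) : V →ₗ[K] K)
  map_add' _ _ := rfl
  map_smul' _ _ := rfl

@[simp]
theorem toDual_apply (χ : LefschetzDual K V) (v : V) : toDual χ v = χ v := rfl

omit [DiscreteTopology K] in
theorem ext {χ χ' : LefschetzDual K V} (h : ∀ v, χ v = χ' v) : χ = χ' :=
  DFunLike.ext _ _ h

theorem toDual_injective : Function.Injective (toDual : LefschetzDual K V →ₗ[K] _) :=
  fun _ _ h => ext fun v => LinearMap.congr_fun h v

/-- Pullback of continuous linear forms along a continuous linear map. -/
noncomputable def pullback (T : V →L[K] W) : LefschetzDual K W →ₗ[K] LefschetzDual K V where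
  toFun χ := (show W →L[K] K from χ) ∘L T
  map_add' _ _ := rfl
  map_smul' _ _ := rfl

@[simp]
theorem pullback_apply (T : V →L[K] W) (χ : LefschetzDual K W) (v : V) :
    pullback T χ v = χ (T v) := rfl

/-- The continuous linear forms vanishing on `Z`. -/
noncomputable def annihilator (Z : Submodule K V) : Submodule K (LefschetzDual K V) :=
  Z.dualAnnihilator.comap toDual

theorem mem_annihilator {Z : Submodule K V} {χ : LefschetzDual K V} :
    χ ∈ annihilator Z ↔ ∀ v ∈ Z, χ v = 0 := by
  simp [annihilator, Submodule.mem_dualAnnihilator]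

theorem mem_perp {P : Submodule K (LefschetzDual K V)} {v : V} :
    v ∈ perp P ↔ ∀ χ ∈ P, χ v = 0 := Iff.rfl

theorem le_perp_iff {Z : Submodule K V} {P : Submodule K (LefschetzDual K V)} :
    Z ≤ perp P ↔ P ≤ annihilator Z :=
  ⟨fun h _ hχ => mem_annihilator.2 fun _ hv => h hv _ hχ,
    fun h _ hv _ hχ => mem_annihilator.1 (h hχ) _ hv⟩

theorem perp_eq_dualCoannihilator (P : Submodule K (LefschetzDual K V)) :
    perp P = (P.map toDual).dualCoannihilator := by
  ext v
  simp [mem_perp, Submodule.mem_dualCoannihilator]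

theorem isOpen_ker (χ : LefschetzDual K V) : IsOpen {v | χ v = 0} :=
  (isOpen_discrete ({0} : Set K)).preimage (show V →L[K] K from χ).continuous

theorem isClosed_perp (P : Submodule K (LefschetzDual K V)) : IsClosed (perp P : Set V) := by
  have : (perp P : Set V) = ⋂ χ ∈ P, {v | χ v = 0} := by
    ext v; simp [mem_perp]
  rw [this]
  exact isClosed_biInter fun χ _ =>
    (isClosed_discrete ({0} : Set K)).preimage (show V →L[K] K from χ).continuous

theorem isOpen_perp (P : Submodule K (LefschetzDual K V)) [Module.Finite K P] :
    IsOpen (perp P : Set V) := by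
  obtain ⟨s, hs⟩ := Module.Finite.iff_fg.1 ‹Module.Finite K P›
  have : (perp P : Set V) = ⋂ χ ∈ s, {v | χ v = 0} := by
    ext v
    simp only [SetLike.mem_coe, Set.mem_iInter, Set.mem_ofPred_eq]
    refine ⟨fun h χ hχ => h χ (hs ▸ Submodule.subset_span hχ), fun h χ hχ => ?_⟩
    have hle : P ≤ annihilator (K ∙ v) := by
      rw [← hs, Submodule.span_le]
      intro χ hχ
      refine mem_annihilator.2 fun w hw => ?_
      obtain ⟨c, rfl⟩ := Submodule.mem_span_singleton.1 hw
      exact (map_smul (toDual χ) c v).trans (by rw [toDual_apply, h χ hχ, smul_zero])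
    exact mem_annihilator.1 (hle hχ) v (Submodule.mem_span_singleton_self v)
  rw [this]
  exact isOpen_biInter_finset fun χ _ => isOpen_ker χ

/-- Evaluation identifies `V ⧸ perp P` with the linear dual of the finite-dimensional space `P`. -/
theorem finrank_quotient_perp (P : Submodule K (LefschetzDual K V)) [Module.Finite K P] :
    Module.Finite K (V ⧸ perp P) ∧ Module.finrank K (V ⧸ perp P) = Module.finrank K P := by
  rw [perp_eq_dualCoannihilator]
  have hQ : FiniteDimensional K (P.map toDual) :=
    Module.Finite.equiv (Submodule.equivMapOfInjective _ toDual_injective P)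
  have e : (V ⧸ (P.map toDual).dualCoannihilator) ≃ₗ[K] Module.Dual K P :=
    (LinearEquiv.ofBijective _
      (Subspace.quotDualCoannihilatorToDual_bijective (P.map toDual))).trans
      (Submodule.equivMapOfInjective _ toDual_injective P).dualMap
  exact ⟨Module.Finite.equiv e.symm, e.finrank_eq.trans Subspace.dual_finrank_eq⟩

/-- The continuous linear form given by a linear form that vanishes on an open subspace. -/
noncomputable def ofLinear [IsTopologicalAddGroup V] (f : V →ₗ[K] K) {U : Submodule K V}
    (hU : IsOpen (U : Set V)) (hf : U ≤ f.ker) : LefschetzDual K V :=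
  (show V →L[K] K from ⟨f, by
    refine continuous_of_continuousAt_zero f ?_
    rw [ContinuousAt, map_zero]
    refine tendsto_nhds_of_eventually_eq ?_
    filter_upwards [hU.mem_nhds U.zero_mem] with x hx using hf hx⟩)

theorem perp_annihilator_of_isOpen [IsTopologicalAddGroup V] {U : Submodule K V}
    (hU : IsOpen (U : Set V)) : perp (annihilator U) = U := by
  refine le_antisymm (fun v hv => ?_) (le_perp_iff.2 le_rfl)
  by_contra hvU
  obtain ⟨f, hfv, hf⟩ := Submodule.exists_le_ker_of_notMem hvU
  exact hfv (hv (ofLinear f hU hf) (mem_annihilator.2 fun w hw => hf hw))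

theorem finite_annihilator [IsTopologicalAddGroup V] (hV : LinearlyCompact K V)
    {U : Submodule K V} (hU : IsOpen (U : Set V)) : Module.Finite K (annihilator U) := by
  have := hV.finite_quotient hU
  have h1 : Module.Finite K U.dualAnnihilator := Module.Finite.equiv U.dualQuotEquivDualAnnihilator
  have h2 : Module.Finite K ((annihilator U).map toDual) :=
    Submodule.finiteDimensional_of_le (Submodule.map_comap_le _ _)
  exact Module.Finite.equiv (Submodule.equivMapOfInjective _ toDual_injective _).symm

theorem perp_annihilator_of_isClosed [IsTopologicalAddGroup V] [IsLinearTopology K V]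
    {Z : Submodule K V} (hZ : IsClosed (Z : Set V)) : perp (annihilator Z) = Z := by
  refine le_antisymm (fun v hv => ?_) (le_perp_iff.2 le_rfl)
  by_contra hvZ
  have hn : {x | v - x ∈ (Z : Set V)ᶜ} ∈ 𝓝 (0 : V) :=
    (hZ.isOpen_compl.preimage (continuous_const.sub continuous_id)).mem_nhds (by simpa using hvZ)
  -- The coset `v + U` misses `Z`, so a linear form can separate `v` from `Z ⊔ U`; vanishing on the
  -- open `U` makes it continuous.
  obtain ⟨U, hU, hUZ⟩ := (IsLinearTopology.hasBasis_open_submodule K).mem_iff.1 hn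
  have hvs : v ∉ Z ⊔ U := by
    rw [Submodule.mem_sup]
    rintro ⟨z, hz, u, hu, rfl⟩
    exact hUZ hu (by simpa using hz)
  obtain ⟨f, hfv, hf⟩ := Submodule.exists_le_ker_of_notMem hvs
  exact hfv (hv (ofLinear f hU (le_sup_right.trans hf))
    (mem_annihilator.2 fun w hw => hf (le_sup_left (a := Z) hw)))

theorem perp_eq_top_iff {P : Submodule K (LefschetzDual K V)} : perp P = ⊤ ↔ P = ⊥ := by
  rw [eq_bot_iff, eq_top_iff, le_perp_iff]
  have : annihilator (⊤ : Submodule K V) = (⊥ : Submodule K (LefschetzDual K V)) :=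
    eq_bot_iff.2 fun χ hχ => ext fun v => mem_annihilator.1 hχ v trivial
  rw [this]

/-- Linear compactness is essential here. If `χ ∉ P`, then `χ = 1` is compatible with any finitely
many equations `ψ = 0`, `ψ ∈ P`, since otherwise `χ` would be a combination of those `ψ`. A common
point lies in `perp P` yet is not killed by `χ`. -/
theorem annihilator_perp (hV : LinearlyCompact K V) (P : Submodule K (LefschetzDual K V)) :
    annihilator (perp P) = P := by
  refine le_antisymm (fun χ hχ => ?_) (le_perp_iff.1 le_rfl)
  have hχ := mem_annihilator.1 hχ
  let L : LefschetzDual K V → AffineSubspace K V := fun ψ => (toDual ψ).ker.toAffineSubspace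
  let H : AffineSubspace K V := (AffineSubspace.mk' (1 : K) ⊥).comap (toDual χ).toAffineMap
  have hL : ∀ ψ x, x ∈ (L ψ : Set V) ↔ ψ x = 0 := fun ψ x => Iff.rfl
  have hH : ∀ x, x ∈ (H : Set V) ↔ χ x = 1 := by
    intro x
    change x ∈ (AffineSubspace.mk' (1 : K) ⊥).comap (toDual χ).toAffineMap ↔ _
    rw [AffineSubspace.mem_comap, AffineSubspace.mem_mk']
    simp [sub_eq_zero]
  by_contra hP
  obtain ⟨x, hx⟩ := hV.fip (insert H (L '' P)) (by
    rintro _ (rfl | ⟨ψ, hψ, rfl⟩)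
    · rw [show (H : Set V) = {x | χ x = 1} from Set.ext hH]
      exact (isClosed_discrete ({1} : Set K)).preimage (show V →L[K] K from χ).continuous
    · rw [show (L ψ : Set V) = {x | ψ x = 0} from Set.ext (hL ψ)]
      exact (isClosed_discrete ({0} : Set K)).preimage (show V →L[K] K from ψ).continuous) (by
    intro T hT hTfin
    obtain ⟨T', hT'P, hT'fin, hT'⟩ :
        ∃ T' ⊆ (P : Set (LefschetzDual K V)), T'.Finite ∧ T ∩ L '' P = L '' T' :=
      Set.exists_subset_image_finite_and.1
        ⟨T ∩ L '' P, Set.inter_subset_right, hTfin.inter_of_left _, rfl⟩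
    have := hT'fin.to_subtype
    have hspan : ¬ (⨅ ψ : T', (toDual (ψ : LefschetzDual K V)).ker) ≤ (toDual χ).ker := by
      intro hle
      have hmem := mem_span_of_iInf_ker_le_ker hle
      have hle' : Submodule.span K (Set.range fun ψ : T' => toDual (ψ : LefschetzDual K V)) ≤
          P.map toDual := by
        rw [Submodule.span_le]
        rintro _ ⟨ψ, rfl⟩
        exact ⟨ψ, hT'P ψ.2, rfl⟩
      obtain ⟨ψ, hψ, he⟩ := hle' hmem
      exact hP (toDual_injective he ▸ hψ)
    obtain ⟨v, hv, hvχ⟩ := SetLike.not_le_iff_exists.1 hspan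
    rw [LinearMap.mem_ker, toDual_apply] at hvχ
    simp only [Submodule.mem_iInf, LinearMap.mem_ker] at hv
    -- Rescaling keeps `v` in the kernels and moves it onto `χ = 1`.
    refine ⟨(χ v)⁻¹ • v, ?_⟩
    simp only [Set.mem_iInter]
    intro s hs
    rcases hT hs with rfl | hs'
    · rw [hH]
      exact (map_smul (toDual χ) _ v).trans (by simp [hvχ])
    · obtain ⟨ψ, hψ, rfl⟩ : s ∈ L '' T' := hT' ▸ ⟨hs, hs'⟩
      rw [hL]
      exact (map_smul (toDual ψ) _ v).trans (by rw [hv ⟨ψ, hψ⟩, smul_zero]))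
  simp only [Set.mem_iInter] at hx
  have h1 := (hH x).1 (hx H (Set.mem_insert _ _))
  have h0 : χ x = 0 := hχ x fun ψ hψ => (hL ψ x).1 (hx _ (Set.mem_insert_of_mem _ ⟨ψ, hψ, rfl⟩))
  exact zero_ne_one (h0.symm.trans h1)

omit [DiscreteTopology K] in
-- `V` is one of the linearly compact subspaces testing the topology, and restriction to it is
-- injective into a discrete space.
theorem discreteTopology (hV : LinearlyCompact K V) : DiscreteTopology (LefschetzDual K V) := by
  have htop : LinearlyCompact K (⊤ : Submodule K V) := hV.of_isClosed isClosed_univ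
  refine ⟨eq_bot_iff.2 ((iInf₂_le (⊤ : Submodule K V) htop).trans ?_)⟩
  intro s _
  refine ⟨(fun χ (a : (⊤ : Submodule K V)) => χ (a : V)) '' s, trivial,
    Set.preimage_image_eq _ fun χ χ' h => ?_⟩
  exact ext fun v => congr_fun h (⟨v, trivial⟩ : (⊤ : Submodule K V))

theorem map_pow_apply (φ : V →L[K] V) (n : ℕ) (χ : LefschetzDual K V) (v : V) :
    (((map φ : LefschetzDual K V →L[K] LefschetzDual K V) :
      LefschetzDual K V →ₗ[K] LefschetzDual K V) ^ n) χ v = χ (((φ : V →ₗ[K] V) ^ n) v) := by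
  induction n generalizing v with
  | zero => rfl
  | succ n ih =>
    rw [pow_succ', pow_succ, Module.End.mul_apply, Module.End.mul_apply]
    exact ih (φ v)

theorem perp_trajectory (φ : V →L[K] V) (F : Submodule K (LefschetzDual K V)) (n : ℕ) :
    perp (trajectory (map φ) F n) = cotrajectory φ (perp F) n := by
  ext v
  have : v ∈ perp (trajectory (map φ) F n) ↔
      trajectory (map φ) F n ≤ annihilator (K ∙ v) := by
    rw [← le_perp_iff, Submodule.span_singleton_le_iff_mem]
  have h2 : ∀ χ, χ ∈ annihilator (K ∙ v) ↔ χ v = 0 := by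
    intro χ
    rw [mem_annihilator]
    refine ⟨fun h => h v (Submodule.mem_span_singleton_self v), fun h w hw => ?_⟩
    obtain ⟨c, rfl⟩ := Submodule.mem_span_singleton.1 hw
    exact (map_smul (toDual χ) c v).trans (by rw [toDual_apply, h, smul_zero])
  rw [this, trajectory_le, mem_cotrajectory]
  simp only [h2, map_pow_apply, mem_perp]

/-- The dimensions agree term by term: codimensions of the cotrajectory and of `perp F` are the
dimensions of the trajectory and of `F`. -/
theorem topEntropyAt_perp (φ : V →L[K] V) (F : Submodule K (LefschetzDual K V))
    [Module.Finite K F] : topEntropyAt φ (perp F) = algEntropyAt (map φ) F := by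
  unfold topEntropyAt algEntropyAt
  congr 1
  ext n
  congr 2
  -- For `n = 0` the trajectory need not contain `F`, so the subtraction of dimensions is
  -- unavailable; both quotients are trivial.
  rcases Nat.eq_zero_or_pos n with rfl | hn
  · have h1 : (cotrajectory φ (perp F) 0).submoduleOf (perp F) = ⊤ := by
      simp [cotrajectory, Submodule.submoduleOf]
    have h2 : trajectory (map φ) F 0 = ⊥ := by simp [trajectory]
    rw [h1, h2]
    have := Submodule.finrank_quotient_le (F.submoduleOf (⊥ : Submodule K (LefschetzDual K V)))
    rw [finrank_bot] at this
    rw [Nat.le_zero.1 this]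
    exact Module.finrank_zero_of_subsingleton
  · have hfin := finite_trajectory (map φ) F n
    obtain ⟨h1, h2⟩ := finrank_quotient_perp (trajectory (map φ) F n)
    obtain ⟨h3, h4⟩ := finrank_quotient_perp F
    rw [perp_trajectory] at h1 h2
    have e1 := finrank_quotient_submoduleOf (le_trajectory (map φ) F hn.ne')
    have e2 := finrank_quotient_submoduleOf_add (cotrajectory_le φ (perp F) hn.ne')
    lia

/-- Both suprema range over the same values: each open `U` is `perp` of its finite-dimensional
annihilator, and `perp F` is open for finite-dimensional `F`. -/
theorem topEntropy_eq_algEntropy_map [IsTopologicalAddGroup V] (hV : LinearlyCompact K V)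
    (φ : V →L[K] V) : topEntropy φ = algEntropy (map φ) := by
  have := discreteTopology hV
  apply le_antisymm
  · refine iSup₂_le fun U hU => ?_
    have hU := hU.1
    have := finite_annihilator hV hU
    rw [← perp_annihilator_of_isOpen hU, topEntropyAt_perp]
    exact le_iSup₂_of_le _ (mem_lcOpens_iff_finite.2 this) le_rfl
  · refine iSup₂_le fun F hF => ?_
    have := mem_lcOpens_iff_finite.1 hF
    rw [← topEntropyAt_perp]
    exact le_iSup₂_of_le _ ((mem_lcOpens_iff_isOpen hV).2 (isOpen_perp F)) le_rfl

end LefschetzDual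

/-! ### Duals of subflows and factors; the Pinsker subspaces -/

namespace LefschetzDual

variable {K V W : Type*} [Field K] [TopologicalSpace K] [DiscreteTopology K]
  [AddCommGroup V] [Module K V] [TopologicalSpace V]
  [AddCommGroup W] [Module K W] [TopologicalSpace W]

/-- The torsion subspace of the dual endomorphism. -/
noncomputable def torsion (φ : V →L[K] V) : Submodule K (LefschetzDual K V) :=
  polyTorsion ((map φ : LefschetzDual K V →L[K] LefschetzDual K V) :
    LefschetzDual K V →ₗ[K] LefschetzDual K V)

theorem torsion_invariant (φ : V →L[K] V) : FlowInvariant (map φ) (torsion φ) :=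
  polyTorsion_invariant _

theorem pullback_intertwines {φ : V →L[K] V} {ψ : W →L[K] W} {T : V →L[K] W}
    (h : ∀ v, T (φ v) = ψ (T v)) (χ : LefschetzDual K W) :
    pullback T (map ψ χ) = map φ (pullback T χ) :=
  ext fun v => by simp [h]

theorem range_pullback_mkQL [IsTopologicalAddGroup V] (Z : Submodule K V) :
    (pullback Z.mkQL : LefschetzDual K (V ⧸ Z) →ₗ[K] _).range = annihilator Z := by
  ext χ
  rw [mem_annihilator]
  constructor
  · rintro ⟨η, rfl⟩ v hv
    have : Z.mkQL v = 0 := by simpa using hv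
    rw [pullback_apply, this]
    exact map_zero (toDual η)
  · intro h
    exact ⟨Z.liftQL (show V →L[K] K from χ) h, ext fun v => rfl⟩

theorem pullback_injective {T : V →L[K] W} (hT : Function.Surjective T) :
    Function.Injective (pullback T : LefschetzDual K W →ₗ[K] LefschetzDual K V) := by
  intro χ χ' h
  refine ext fun w => ?_
  obtain ⟨v, rfl⟩ := hT w
  exact DFunLike.congr_fun h v

/-- A Hahn–Banach extension: a continuous form on `Z` kills `Z ∩ U` for some open `U`, so it
descends to the image of `Z` in `V ⧸ U` and extends linearly from there. -/
theorem pullback_subtypeL_surjective [IsTopologicalAddGroup V] [IsLinearTopology K V]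
    (Z : Submodule K V) :
    Function.Surjective (pullback Z.subtypeL : LefschetzDual K V →ₗ[K] LefschetzDual K Z) := by
  intro η
  have hn : {z : Z | η z = 0} ∈ 𝓝 (0 : Z) := (isOpen_ker η).mem_nhds (map_zero (toDual η))
  rw [nhds_subtype_eq_comap] at hn
  obtain ⟨U, hU, hUη⟩ :=
    ((IsLinearTopology.hasBasis_open_submodule K (M := V)).comap (Subtype.val : Z → V)).mem_iff.1 hn
  obtain ⟨g, hg⟩ : ∃ g : (V ⧸ U) →ₗ[K] K, g ∘ₗ (U.mkQ ∘ₗ Z.subtype) = toDual η := by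
    suffices toDual η ∈ (U.mkQ ∘ₗ Z.subtype).dualMap.range from this
    rw [LinearMap.range_dualMap_eq_dualAnnihilator_ker, Submodule.mem_dualAnnihilator]
    intro z hz
    rw [LinearMap.mem_ker, LinearMap.comp_apply, Submodule.mkQ_apply,
      Submodule.Quotient.mk_eq_zero] at hz
    exact hUη hz
  refine ⟨ofLinear (g ∘ₗ U.mkQ) hU fun x hx => by simp [(Submodule.Quotient.mk_eq_zero U).2 hx],
    ext fun z => ?_⟩
  exact LinearMap.congr_fun hg z

theorem ker_pullback_subtypeL (Z : Submodule K V) :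
    (pullback Z.subtypeL : LefschetzDual K V →ₗ[K] LefschetzDual K Z).ker = annihilator Z := by
  ext χ
  rw [mem_annihilator, LinearMap.mem_ker]
  exact ⟨fun h v hv => DFunLike.congr_fun h ⟨v, hv⟩, fun h => ext fun v => h v v.2⟩

theorem topEntropy_eq_zero_iff [IsTopologicalAddGroup V] (hV : LinearlyCompact K V)
    {φ : V →L[K] V} : topEntropy φ = 0 ↔ torsion φ = ⊤ := by
  have := discreteTopology hV
  rw [topEntropy_eq_algEntropy_map hV, algEntropy_eq_zero_iff, torsion]

/-- The dual of `V ⧸ Z` embeds equivariantly with image `annihilator Z`, and an injective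
intertwiner reflects torsion. -/
theorem topEntropy_quotientFlow_eq_zero_iff [IsTopologicalAddGroup V]
    (hV : LinearlyCompact K V) {φ : V →L[K] V} {Z : Submodule K V} (hZ : FlowInvariant φ Z) :
    topEntropy (quotientFlow φ Z hZ) = 0 ↔ annihilator Z ≤ torsion φ := by
  rw [topEntropy_eq_zero_iff (hV.quotient Z), ← range_pullback_mkQL, eq_top_iff]
  have h : ∀ η : LefschetzDual K (V ⧸ Z),
      pullback Z.mkQL η ∈ torsion φ ↔ η ∈ torsion (quotientFlow φ Z hZ) := fun η =>
    map_mem_polyTorsion_iff (pullback_injective Z.mkQ_surjective)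
      (pullback_intertwines (φ := φ) (ψ := quotientFlow φ Z hZ) fun _ => rfl)
  constructor
  · rintro hT _ ⟨η, rfl⟩
    exact (h η).2 (hT trivial)
  · exact fun hT η _ => (h η).1 (hT ⟨η, rfl⟩)

theorem topEntropy_quotientFlow_eq_zero_iff_perp_le [IsTopologicalAddGroup V]
    [IsLinearTopology K V] (hV : LinearlyCompact K V) {φ : V →L[K] V} {Z : Submodule K V}
    (hZ : FlowInvariant φ Z) (hc : IsClosed (Z : Set V)) :
    topEntropy (quotientFlow φ Z hZ) = 0 ↔ perp (torsion φ) ≤ Z := by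
  rw [topEntropy_quotientFlow_eq_zero_iff hV]
  constructor
  · intro h
    rw [← perp_annihilator_of_isClosed hc]
    exact fun v hv χ hχ => hv χ (h hχ)
  · intro h
    rw [← annihilator_perp hV (torsion φ)]
    exact fun χ hχ => mem_annihilator.2 fun v hv => mem_annihilator.1 hχ v (h hv)

/-- Zero-entropy factors come from the closed invariant `Z` above `perp (torsion φ)`; only `⊤` is
such exactly when that annihilator is `⊤`. -/
theorem cpTopEntropy_iff [IsTopologicalAddGroup V] [IsLinearTopology K V]
    (hV : LinearlyCompact K V) {φ : V →L[K] V} : CPTopEntropy φ ↔ torsion φ = ⊥ := by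
  rw [← perp_eq_top_iff]
  constructor
  · intro h
    by_contra hne
    have hc := isClosed_perp (torsion φ)
    have hi := perp_invariant (torsion_invariant φ)
    exact h _ hi hc hne ((topEntropy_quotientFlow_eq_zero_iff_perp_le hV hi hc).2 le_rfl)
  · intro h Z hZ hc hne h0
    rw [topEntropy_quotientFlow_eq_zero_iff_perp_le hV hZ hc, h] at h0
    exact hne (top_le_iff.1 h0)

theorem isLeast_perp_torsion [IsTopologicalAddGroup V] [IsLinearTopology K V]
    (hV : LinearlyCompact K V) (φ : V →L[K] V) :
    IsLeast (zeroTopFactorKernels φ) (perp (torsion φ)) :=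
  have hc := isClosed_perp (torsion φ)
  have hi := perp_invariant (torsion_invariant φ)
  ⟨⟨hc, hi, (topEntropy_quotientFlow_eq_zero_iff_perp_le hV hi hc).2 le_rfl⟩,
    fun _ ⟨hc', hZ, h⟩ => (topEntropy_quotientFlow_eq_zero_iff_perp_le hV hZ hc').1 h⟩

/-- The dual of `perp (torsion φ)` is the full dual modulo its torsion, hence torsion-free. If the
dual of `Z` is torsion-free, torsion forms restrict to zero on `Z`. -/
theorem isGreatest_perp_torsion [IsTopologicalAddGroup V] [IsLinearTopology K V]
    (hV : LinearlyCompact K V) (φ : V →L[K] V) :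
    IsGreatest (cpTopSubspaces φ) (perp (torsion φ)) := by
  have key : ∀ (Z : Submodule K V) (hZ : FlowInvariant φ Z) (χ : LefschetzDual K V),
      pullback Z.subtypeL (map φ χ) = map (subflow φ Z hZ) (pullback Z.subtypeL χ) :=
    fun Z hZ => pullback_intertwines fun _ => rfl
  constructor
  · have hc := isClosed_perp (torsion φ)
    refine ⟨hc, perp_invariant (torsion_invariant φ), ?_⟩
    have := (perp (torsion φ)).isLinearTopology
    rw [cpTopEntropy_iff (hV.of_isClosed hc), eq_bot_iff]
    rintro η ⟨p, hp, hpη⟩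
    obtain ⟨χ, rfl⟩ := pullback_subtypeL_surjective _ η
    rw [← aeval_apply_of_intertwines (f := ((map φ : LefschetzDual K V →L[K] LefschetzDual K V) :
      LefschetzDual K V →ₗ[K] LefschetzDual K V)) _ (key _ _), ← LinearMap.mem_ker,
      ker_pullback_subtypeL, annihilator_perp hV] at hpη
    have hχ : χ ∈ torsion φ := mem_polyTorsion_of_aeval hp hpη
    rw [Submodule.mem_bot, ← LinearMap.mem_ker, ker_pullback_subtypeL]
    exact le_perp_iff.1 le_rfl hχ
  · rintro Z ⟨hc, hZ, h⟩
    have := Z.isLinearTopology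
    rw [cpTopEntropy_iff (hV.of_isClosed hc)] at h
    rw [le_perp_iff, ← ker_pullback_subtypeL]
    intro χ hχ
    have : pullback Z.subtypeL χ ∈ torsion (subflow φ Z hZ) :=
      map_mem_polyTorsion _ (key Z hZ) hχ
    rw [h] at this
    exact this

/-- The dual of a closed subflow is the quotient of the dual by the annihilator. -/
theorem flowIso_map_subflow [IsTopologicalAddGroup V] [IsLinearTopology K V]
    (hV : LinearlyCompact K V) (φ : V →L[K] V) {Z : Submodule K V} (hc : IsClosed (Z : Set V))
    (hZ : FlowInvariant φ Z) {P : Submodule K (LefschetzDual K V)} (hP : annihilator Z = P)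
    (hPi : FlowInvariant (map φ) P) :
    FlowIso (map (subflow φ Z hZ)) (quotientFlow (map φ) P hPi) := by
  have := discreteTopology hV
  have := discreteTopology (hV.of_isClosed hc)
  have := P.discreteTopology_quotient_of_discrete
  let e : (LefschetzDual K V ⧸ P) ≃ₗ[K] LefschetzDual K Z :=
    (Submodule.quotEquivOfEq _ _ (by rw [ker_pullback_subtypeL, hP])).trans
      ((pullback Z.subtypeL).quotKerEquivOfSurjective (pullback_subtypeL_surjective Z))
  refine ⟨⟨e.symm, continuous_of_discreteTopology, continuous_of_discreteTopology⟩, fun η => ?_⟩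
  obtain ⟨x, rfl⟩ := e.surjective η
  obtain ⟨χ, rfl⟩ := P.mkQ_surjective x
  change e.symm (map (subflow φ Z hZ) (e (P.mkQ χ))) =
    quotientFlow (map φ) P hPi (e.symm (e (P.mkQ χ)))
  rw [e.symm_apply_apply, e.symm_apply_eq]
  rfl

end LefschetzDual

/-! ### Assembly of the theorem -/

theorem theoremB {K V : Type*} [Field K] [TopologicalSpace K] [DiscreteTopology K]
    [AddCommGroup V] [Module K V] [TopologicalSpace V] [IsTopologicalAddGroup V]
    [ContinuousSMul K V] [T2Space V] [IsLinearTopology K V] [LinearlyCompact K V]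
    (φ : V →L[K] V) :
    -- `D₊(V, φ)` is the largest closed invariant subspace of completely positive topological
    -- entropy, and `V / D₊(V, φ)` is the largest factor of zero topological entropy
    IsGreatest (cpTopSubspaces φ) (domainCP φ) ∧
    IsLeast (zeroTopFactorKernels φ) (domainCP φ) ∧
    -- the Pinsker subspace of the dual flow is its largest invariant subspace of zero algebraic
    -- entropy, and its quotient is the largest factor of completely positive algebraic entropy
    IsGreatest (zeroAlgSubspaces (LefschetzDual.map φ))
      (pinskerSubspace (LefschetzDual.map φ)) ∧
    IsLeast (cpAlgFactorKernels (LefschetzDual.map φ))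
      (pinskerSubspace (LefschetzDual.map φ)) ∧
    -- the isomorphism of Pinsker factors
    FlowIso (pinskerFactorMap φ)
      (quotientFlow φ (LefschetzDual.pinskerPerp φ) (LefschetzDual.pinskerPerp_invariant φ)) ∧
    FlowIso (subflow φ (domainCP φ) (domainCP_invariant φ))
      (subflow φ (LefschetzDual.pinskerPerp φ) (LefschetzDual.pinskerPerp_invariant φ)) ∧
    FlowIso (LefschetzDual.map (subflow φ (domainCP φ) (domainCP_invariant φ)))
      (factorCPMap (LefschetzDual.map φ)) ∧
    (CPTopEntropy φ ↔ CPAlgEntropy (LefschetzDual.map φ)) := by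
  have hV : LinearlyCompact K V := inferInstance
  have := LefschetzDual.discreteTopology hV
  have hG := LefschetzDual.isGreatest_perp_torsion hV φ
  have hD : domainCP φ = LefschetzDual.perp (LefschetzDual.torsion φ) := hG.isLUB.sSup_eq
  have hP : pinskerSubspace (LefschetzDual.map φ) = LefschetzDual.torsion φ :=
    pinskerSubspace_eq _
  -- The two subspaces coincide, so the identity gives the first two isomorphisms.
  have hDP : domainCP φ = LefschetzDual.pinskerPerp φ := by
    rw [hD, LefschetzDual.pinskerPerp, hP]
  refine ⟨hD ▸ hG, hD ▸ LefschetzDual.isLeast_perp_torsion hV φ, hP ▸ isGreatest_polyTorsion _,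
    hP ▸ isLeast_polyTorsion _, flowIso_quotientFlow_of_eq φ hDP _ _,
    flowIso_subflow_of_eq φ hDP _ _, ?_, ?_⟩
  · refine LefschetzDual.flowIso_map_subflow hV φ ?_ _ ?_ _
    · rw [hD]
      exact LefschetzDual.isClosed_perp _
    · rw [hD, hP, LefschetzDual.annihilator_perp hV]
  · rw [LefschetzDual.cpTopEntropy_iff hV, cpAlgEntropy_iff, LefschetzDual.torsion]
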